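/- All groups are finite. For a group $G$ let $\pi(G)$ be the set of prime divisors of $|G|$ and $\Phi(G)$ the Frattini subgroup. A Schmidt group is a non-nilpotent group all of whose proper subgroups are nilpotent; a Schmidt $(p,q)$-group is a Schmidt group $H$ with $\pi(H)=\{p,q\}$ and normal Sylow $p$-subgroup. A (directed) graph is a pair of a vertex set and a set of ordered pairs of vertices; inclusion and union of graphs are taken for vertices and for edges. The Schmidt graph $\Gamma_{Sch}(G)$ has vertex set $\pi(G)$, and $(p,q)$ is an edge if and only if $G$ contains a Schmidt $(p,q)$-group as a subgroup. **Proposition.** The function $\Gamma=\Gamma_{Sch}$ is an arithmetic graph function (the vertices of $\Gamma(G)$ are divisors of $|G|$, and $\Gamma(1)=\emptyset$), and it is - $\mathbf{S}$-closed: $\Gamma(H)\subseteq\Gamma(G)$ for every group $G$ and every $H\le G$; - $\mathbf{Q}$-closed: $\Gamma(G/N)\subseteq\Gamma(G)$ for every group $G$ and every $N\trianglelefteq G$; - $\mathbf{D}_0$-closed: $\Gamma(G_1\times\dots\times G_n)=\Gamma(G_1)\cup\dots\cup\Gamma(G_n)$ for all groups $G_1,\dots,G_n$; - $\mathbf{R}_0$-closed: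 $\Gamma(G/N_1)\cup\dots\cup\Gamma(G/N_n)=\Gamma\bigl(G/\bigcap_{i=1}^n N_i\bigr)$ for every group $G$ and all normal subgroups $N_1,\dots,N_n$ of $G$. It is not $\mathbf{E}_\Phi$-closed: it is not true that $\Gamma(G/\Phi(G))=\Gamma(G)$ for every group $G$. More precisely, there are a faithful irreducible $\mathbb{F}_3A_5$-module $A$ and a finite group $R$ with an exact sequence $A\rightarrowtail R\twoheadrightarrow A_5$ that is a Frattini extension (conjugation in $R$ induces on $A$ the given action of $A_5$, and the image of $A$ is contained in $\Phi(R)$; so $A$ is a Frattini module), such that the image of $A$ equals $\Phi(R)$, $R/\Phi(R)\simeq A_5$, $R$ contains a Schmidt $(3,5)$-subgroup, $A_5$ contains no Schmidt $(3,5)$-subgroup, and hence $\Gamma(R/\Phi(R))\neq\Gamma(R)$. -/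

import Mathlib

universe u

/-- The set `π(G)` of prime divisors of the order of a finite group `G`. -/
def primeDivisors (G : Type*) [Group G] : Set ℕ :=
  {p | p.Prime ∧ p ∣ Nat.card G}

/-- A directed graph (loops allowed) whose vertices are natural numbers: a set of vertices and a
set of ordered pairs of vertices. -/
@[ext]
structure NatDigraph where
  verts : Set ℕ
  edges : Set (ℕ × ℕ)
  edges_subset : edges ⊆ verts ×ˢ verts

namespace NatDigraph

/-- `Γ₁ ≤ Γ₂` means that `Γ₁` is a subgraph of `Γ₂`. -/
instance : LE NatDigraph where
  le Γ₁ Γ₂ := Γ₁.verts ⊆ Γ₂.verts ∧ Γ₁.edges ⊆ Γ₂.edges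

/-- The graph with no vertices. -/
def empty : NatDigraph where
  verts := ∅
  edges := ∅
  edges_subset := Set.empty_subset _

/-- The union of a family of graphs. -/
def union {ι : Type*} (Γ : ι → NatDigraph) : NatDigraph where
  verts := ⋃ i, (Γ i).verts
  edges := ⋃ i, (Γ i).edges
  edges_subset := by
    intro e he
    obtain ⟨i, hi⟩ := Set.mem_iUnion.mp he
    have h := (Γ i).edges_subset hi
    exact ⟨Set.mem_iUnion.mpr ⟨i, h.1⟩, Set.mem_iUnion.mpr ⟨i, h.2⟩⟩

end NatDigraph

/-- A graph function assigns a graph to every finite group. -/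
abbrev GraphFunction : Type (u + 1) :=
  (G : Type u) → [Group G] → [Finite G] → NatDigraph

namespace GraphFunction

/-- The vertices of `Γ(G)` are divisors of `|G|`, and `Γ(1)` is the empty graph. -/
def IsArithmetic (Γ : GraphFunction.{u}) : Prop :=
  (∀ (G : Type u) [Group G] [Finite G], (Γ G).verts ⊆ {d | d ∣ Nat.card G}) ∧
  (∀ (G : Type u) [Group G] [Finite G], Subsingleton G → Γ G = NatDigraph.empty)

/-- `Γ(H) ⊆ Γ(G)` for all subgroups `H ≤ G`. -/
def SClosed (Γ : GraphFunction.{u}) : Prop :=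
  ∀ (G : Type u) [Group G] [Finite G] (H : Subgroup G), Γ H ≤ Γ G

/-- `Γ(G/N) ⊆ Γ(G)` for all normal subgroups `N` of `G`. -/
def QClosed (Γ : GraphFunction.{u}) : Prop :=
  ∀ (G : Type u) [Group G] [Finite G] (N : Subgroup G) [N.Normal], Γ (G ⧸ N) ≤ Γ G

/-- `Γ(G₁ × ⋯ × Gₙ) = Γ(G₁) ∪ ⋯ ∪ Γ(Gₙ)`. -/
def D0Closed (Γ : GraphFunction.{u}) : Prop :=
  ∀ (n : ℕ) (G : Fin n → Type u) [∀ i, Group (G i)] [∀ i, Finite (G i)],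
    Γ ((i : Fin n) → G i) = NatDigraph.union fun i => Γ (G i)

/-- `Γ(G/N₁) ∪ ⋯ ∪ Γ(G/Nₙ) = Γ(G/(N₁ ∩ ⋯ ∩ Nₙ))` for all normal subgroups `N₁, …, Nₙ` of `G`. -/
def R0Closed (Γ : GraphFunction.{u}) : Prop :=
  ∀ (G : Type u) [Group G] [Finite G] (n : ℕ) (N : Fin n → Subgroup G)
    (hN : ∀ i, (N i).Normal),
    haveI : (⨅ i, N i).Normal := Subgroup.normal_iInf_normal hN
    (NatDigraph.union fun i => Γ (G ⧸ N i)) = Γ (G ⧸ ⨅ i, N i)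

/-- `Γ(G/Φ(G)) = Γ(G)` for every group `G`. -/
def EPhiClosed (Γ : GraphFunction.{u}) : Prop :=
  ∀ (G : Type u) [Group G] [Finite G], Γ (G ⧸ frattini G) = Γ G

end GraphFunction

/-- A Schmidt group is a non-nilpotent group all of whose proper subgroups are nilpotent. -/
def IsSchmidt (G : Type*) [Group G] : Prop :=
  ¬ Group.IsNilpotent G ∧ ∀ H : Subgroup G, H ≠ ⊤ → Group.IsNilpotent H

/-- A Schmidt `(p, q)`-group is a Schmidt group `G` with `π(G) = {p, q}` and normal Sylow
`p`-subgroup. -/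
def IsSchmidtPQ (p q : ℕ) (G : Type*) [Group G] : Prop :=
  IsSchmidt G ∧ primeDivisors G = {p, q} ∧ ∃ P : Sylow p G, (P : Subgroup G).Normal

/-- `G` contains a Schmidt `(p, q)`-group as a subgroup. -/
def HasSchmidtSubgroup (p q : ℕ) (G : Type*) [Group G] : Prop :=
  ∃ H : Subgroup G, IsSchmidtPQ p q H

/-- The Schmidt graph function `Γ_Sch`. -/
def schmidtGraph : GraphFunction.{u} := fun G _ _ =>
  { verts := primeDivisors G
    edges := {e | HasSchmidtSubgroup e.1 e.2 G}
    edges_subset := by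
      rintro ⟨p, q⟩ ⟨H, -, hπ, -⟩
      have key : ∀ r ∈ primeDivisors H, r ∈ primeDivisors G := fun r hr =>
        ⟨hr.1, hr.2.trans (Subgroup.card_subgroup_dvd_card H)⟩
      exact ⟨key p (by rw [hπ]; exact Or.inl rfl), key q (by rw [hπ]; exact Or.inr rfl)⟩ }

/-- The exact sequence `A ↣ R ↠ G` is a Frattini extension of `G` by the `KG`-module `(A, ρ)`:
conjugation in `R` induces on `A` the given action of `G`, and the image of `A` lies in `Φ(R)`.
A finite module that occurs in such a sequence with `R` finite is called a Frattini `KG`-module. -/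
structure IsFrattiniExtension {K G A R : Type*} [Field K] [Group G] [AddCommGroup A] [Module K A]
    [Group R] (ρ : Representation K G A) (S : GroupExtension (Multiplicative A) R G) : Prop where
  conj_eq : ∀ (r : R) (a : A), r * S.inl (Multiplicative.ofAdd a) * r⁻¹ =
    S.inl (Multiplicative.ofAdd (ρ (S.rightHom r) a))
  range_le_frattini : S.inl.range ≤ frattini R

/-! Being Schmidt passes to neither subgroups nor quotients, so the edge condition is first
weakened: `G` has a Schmidt `(p, q)`-subgroup iff it has a non-nilpotent subgroup that is a
`p`-group extended by a `q`-group (`hasSchmidtSubgroup_iff`). The weaker property survives in every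
non-nilpotent subgroup or quotient, which gives S-closure. Lifting it along a surjection is a
Frattini argument and gives Q-closure. For products, a subgroup with all projections nilpotent is
nilpotent. R₀-closure combines these facts, since `G/⋂Nᵢ` embeds in `∏ G/Nᵢ`.

For the counterexample, `A` is the sum-zero part of `𝔽₃⁵`. A 5-cycle acts on it without nonzero
fixed vectors and already irreducibly. The stabiliser `A₄` of a point permutes the three pairings of
the other four points through `C₃`; recording these rotations gives a cocycle `A₅ → 𝔽₃⁵`. The group
`R` consists of the sum-zero lifts of this cocycle to `ℤ/9`, inside `C₉ ≀ A₅`, and is an extension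
of `A₅` by `3·(ℤ/9)⁵ ∩ {sum zero} ≅ A`. No element of `R` over a certain 3-cycle has order 3, so `A`
has no complement; by irreducibility `A ≤ Φ(R)`. The preimage of a group of order 5 is a
non-nilpotent 3-by-5 group, while a `(3, 5)`-subgroup of `A₅` would have order 15 and so be
nilpotent. -/

open Subgroup

/-! ### Non-nilpotent extensions of `p`-groups by `q`-groups -/

/-- `G` is a non-nilpotent extension of a `p`-group by a `q`-group for primes `p ≠ q`. -/
structure IsNonnilpotentPByQ (p q : ℕ) (G : Type*) [Group G] : Prop where
  prime_left : p.Prime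
  prime_right : q.Prime
  ne : p ≠ q
  not_nilpotent : ¬ Group.IsNilpotent G
  exists_normal : ∃ P : Subgroup G, P.Normal ∧ IsPGroup p P ∧ ∀ g : G, ∃ k : ℕ, g ^ q ^ k ∈ P

theorem isNilpotent_of_primeDivisors_subset {G : Type*} [Group G] [Finite G] {p : ℕ}
    (hp : p.Prime) (h : primeDivisors G ⊆ {p}) : Group.IsNilpotent G := by
  have := Fact.mk hp
  have h1 := Nat.eq_prime_pow_of_unique_prime_dvd (n := Nat.card G) (p := p) Nat.card_pos.ne'
    (fun {d} hd hdvd => h ⟨hd, hdvd⟩)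
  exact (IsPGroup.of_card h1).isNilpotent

theorem mem_primeDivisors_of_isPGroup_by {G : Type*} [Group G] [Finite G] {p q r : ℕ}
    (hp : p.Prime) (hq : q.Prime) {P : Subgroup G} (hP : IsPGroup p P)
    (hQ : ∀ g : G, ∃ k : ℕ, g ^ q ^ k ∈ P) (hr : r ∈ primeDivisors G) : r = p ∨ r = q := by
  obtain ⟨hr, hd⟩ := hr
  have := Fact.mk hr
  obtain ⟨g, hg⟩ := exists_prime_orderOf_dvd_card' r hd
  obtain ⟨k, hk⟩ := hQ g
  obtain ⟨m, hm⟩ := hP ⟨_, hk⟩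
  have h1 : g ^ (q ^ k * p ^ m) = 1 := by
    rw [pow_mul]; exact congrArg Subtype.val hm
  have h2 := orderOf_dvd_of_pow_eq_one h1
  rw [hg] at h2
  rcases (Nat.Prime.dvd_mul hr).1 h2 with h | h
  · exact Or.inr ((Nat.prime_dvd_prime_iff_eq hr hq).1 (hr.dvd_of_dvd_pow h))
  · exact Or.inl ((Nat.prime_dvd_prime_iff_eq hr hp).1 (hr.dvd_of_dvd_pow h))

theorem not_dvd_index_of_forall_pow_mem {G : Type*} [Group G] [Finite G] {p q : ℕ}
    (hp : p.Prime) (hq : q.Prime) (hpq : p ≠ q) {P : Subgroup G} [P.Normal]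
    (hQ : ∀ g : G, ∃ k : ℕ, g ^ q ^ k ∈ P) : ¬ p ∣ P.index := by
  intro hd
  have := Fact.mk hp
  obtain ⟨x, hx⟩ := exists_prime_orderOf_dvd_card' (G := G ⧸ P) p hd
  obtain ⟨g, rfl⟩ := QuotientGroup.mk_surjective x
  obtain ⟨k, hk⟩ := hQ g
  have h1 : (g : G ⧸ P) ^ q ^ k = 1 := by
    rw [← QuotientGroup.mk_pow]; exact (QuotientGroup.eq_one_iff _).2 hk
  have h2 := orderOf_dvd_of_pow_eq_one h1
  rw [hx] at h2
  exact hpq ((Nat.prime_dvd_prime_iff_eq hp hq).1 (hp.dvd_of_dvd_pow h2))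

theorem IsSchmidtPQ.isNonnilpotentPByQ {p q : ℕ} {G : Type*} [Group G] [Finite G]
    (h : IsSchmidtPQ p q G) : IsNonnilpotentPByQ p q G := by
  obtain ⟨⟨hn, -⟩, hπ, P, hP⟩ := h
  have hp : p ∈ primeDivisors G := by rw [hπ]; exact Or.inl rfl
  have hq : q ∈ primeDivisors G := by rw [hπ]; exact Or.inr rfl
  have := Fact.mk hp.1
  have := Fact.mk hq.1
  refine ⟨hp.1, hq.1, ?_, hn, P, hP, P.2, ?_⟩
  · rintro rfl
    exact hn (isNilpotent_of_primeDivisors_subset hp.1 (by rw [hπ]; simp))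
  · have h1 : ¬ p ∣ (P : Subgroup G).index := P.not_dvd_index
    have h2 := Nat.eq_prime_pow_of_unique_prime_dvd (n := (P : Subgroup G).index) (p := q)
      (Subgroup.index_ne_zero_of_finite) (fun {d} hd hdvd => by
        have : d ∈ primeDivisors G := ⟨hd, hdvd.trans (Subgroup.index_dvd_card _)⟩
        rw [hπ] at this
        rcases this with rfl | h
        · exact absurd hdvd h1
        · exact h)
    intro g
    refine ⟨(P : Subgroup G).index.primeFactorsList.length, ?_⟩
    rw [← h2]
    exact Subgroup.pow_index_mem _ g

theorem IsNonnilpotentPByQ.isSchmidtPQ {p q : ℕ} {G : Type*} [Group G] [Finite G]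
    (h : IsNonnilpotentPByQ p q G) (hs : IsSchmidt G) : IsSchmidtPQ p q G := by
  obtain ⟨hp, hq, hpq, hn, P, hP, hP1, hQ⟩ := h
  have := Fact.mk hp
  have hsub : ∀ r ∈ primeDivisors G, r = p ∨ r = q := fun r hr =>
    mem_primeDivisors_of_isPGroup_by hp hq hP1 hQ hr
  refine ⟨hs, Set.Subset.antisymm hsub ?_,
    hP1.toSylow (not_dvd_index_of_forall_pow_mem hp hq hpq hQ), by simpa using hP⟩
  rintro r (rfl | rfl) <;> by_contra hr
  · exact hn (isNilpotent_of_primeDivisors_subset hq fun s hs =>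
      (hsub s hs).resolve_left (by rintro rfl; exact hr hs))
  · exact hn (isNilpotent_of_primeDivisors_subset hp fun s hs =>
      (hsub s hs).resolve_right (by rintro rfl; exact hr hs))

theorem IsNonnilpotentPByQ.of_injective {p q : ℕ} {G G' : Type*} [Group G] [Group G']
    (h : IsNonnilpotentPByQ p q G) (f : G' →* G) (hf : Function.Injective f)
    (hn : ¬ Group.IsNilpotent G') : IsNonnilpotentPByQ p q G' := by
  obtain ⟨hp, hq, hpq, -, P, hP, hP1, hQ⟩ := h
  refine ⟨hp, hq, hpq, hn, P.comap f, hP.comap f, hP1.comap_of_injective f hf, fun g => ?_⟩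
  obtain ⟨k, hk⟩ := hQ (f g)
  exact ⟨k, by rwa [Subgroup.mem_comap, map_pow]⟩

theorem IsNonnilpotentPByQ.of_surjective {p q : ℕ} {G G' : Type*} [Group G] [Group G']
    (h : IsNonnilpotentPByQ p q G) (f : G →* G') (hf : Function.Surjective f)
    (hn : ¬ Group.IsNilpotent G') : IsNonnilpotentPByQ p q G' := by
  obtain ⟨hp, hq, hpq, -, P, hP, hP1, hQ⟩ := h
  refine ⟨hp, hq, hpq, hn, P.map f, hP.map f hf, hP1.map f, fun g => ?_⟩
  obtain ⟨g, rfl⟩ := hf g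
  obtain ⟨k, hk⟩ := hQ g
  exact ⟨k, by rw [← map_pow]; exact Subgroup.mem_map_of_mem f hk⟩

theorem not_isNilpotent_of_surjective {G G' : Type*} [Group G] [Group G'] (f : G →* G')
    (hf : Function.Surjective f) (h : ¬ Group.IsNilpotent G') : ¬ Group.IsNilpotent G :=
  fun _ => h (Group.nilpotent_of_surjective f hf)

theorem not_isNilpotent_of_injective {G G' : Type*} [Group G] [Group G'] (f : G →* G')
    (hf : Function.Injective f) (h : ¬ Group.IsNilpotent G) : ¬ Group.IsNilpotent G' := fun _ =>
  h (Group.nilpotent_of_mulEquiv (f.ofInjective hf).symm)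

theorem exists_isSchmidt_subgroup {G : Type*} [Group G] [Finite G] (h : ¬ Group.IsNilpotent G) :
    ∃ H : Subgroup G, IsSchmidt H := by
  obtain ⟨H, hH⟩ := Set.Finite.exists_minimal (s := {H : Subgroup G | ¬ Group.IsNilpotent H})
    (Set.toFinite _) ⟨⊤, mt Group.isNilpotent_top.1 h⟩
  refine ⟨H, hH.1, fun K hK => ?_⟩
  by_contra hn
  have hle : K.map H.subtype ≤ H := map_subtype_le K
  have h1 := hH.2 (y := K.map H.subtype) (not_isNilpotent_of_injective
    (K.equivMapOfInjective H.subtype H.subtype_injective).toMonoidHom (MulEquiv.injective _) hn) hle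
  exact hK (by
    rw [eq_top_iff]
    intro x _
    obtain ⟨y, hy, hyx⟩ := h1 x.2
    rwa [← H.subtype_injective hyx])

/-- A minimal non-nilpotent subgroup of `H` is Schmidt and inherits the normal `p`-subgroup; both
primes divide its order, as otherwise it would be a group of prime power order. -/
theorem hasSchmidtSubgroup_iff {p q : ℕ} {G : Type*} [Group G] [Finite G] :
    HasSchmidtSubgroup p q G ↔ ∃ H : Subgroup G, IsNonnilpotentPByQ p q H := by
  refine ⟨fun ⟨H, hH⟩ => ⟨H, hH.isNonnilpotentPByQ⟩, fun ⟨H, hH⟩ => ?_⟩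
  obtain ⟨K, hK⟩ := exists_isSchmidt_subgroup hH.not_nilpotent
  have e := K.equivMapOfInjective H.subtype H.subtype_injective
  have hn : ¬ Group.IsNilpotent (K.map H.subtype) :=
    not_isNilpotent_of_injective e.toMonoidHom e.injective hK.1
  refine ⟨K.map H.subtype, ((hH.of_injective K.subtype K.subtype_injective hK.1).of_surjective
    e.toMonoidHom e.surjective hn).isSchmidtPQ ⟨hn, fun L hL => ?_⟩⟩
  by_contra h
  refine hL ?_
  have h2 : L.comap e.toMonoidHom = ⊤ := by
    by_contra h3
    have := hK.2 _ h3
    exact h (Group.nilpotent_of_surjective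
      (e.toMonoidHom.subgroupComap L)
      (MonoidHom.subgroupComap_surjective_of_surjective _ _ e.surjective))
  rw [eq_top_iff]
  intro x _
  obtain ⟨y, rfl⟩ := e.surjective x
  have : y ∈ L.comap e.toMonoidHom := by rw [h2]; trivial
  exact this

theorem IsNonnilpotentPByQ.hasSchmidtSubgroup {p q : ℕ} {G G' : Type*} [Group G] [Group G']
    [Finite G'] (h : IsNonnilpotentPByQ p q G) (f : G →* G') (hf : Function.Injective f) :
    HasSchmidtSubgroup p q G' :=
  hasSchmidtSubgroup_iff.2 ⟨f.range, h.of_surjective f.rangeRestrict f.rangeRestrict_surjective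
    (not_isNilpotent_of_injective (f.ofInjective hf).toMonoidHom (MulEquiv.injective _)
      h.not_nilpotent)⟩

theorem HasSchmidtSubgroup.of_injective {p q : ℕ} {G G' : Type*} [Group G] [Group G']
    [Finite G] [Finite G'] (h : HasSchmidtSubgroup p q G) (f : G →* G')
    (hf : Function.Injective f) : HasSchmidtSubgroup p q G' := by
  obtain ⟨H, hH⟩ := hasSchmidtSubgroup_iff.1 h
  exact hH.hasSchmidtSubgroup (f.comp H.subtype) (hf.comp H.subtype_injective)

theorem exists_pow_mem_of_mem_sup {G : Type*} [Group G] {q : ℕ} {P Q : Subgroup G} [P.Normal]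
    (hQ : IsPGroup q Q) {g : G} (hg : g ∈ P ⊔ Q) : ∃ k : ℕ, g ^ q ^ k ∈ P := by
  have h1 : QuotientGroup.mk' P g ∈ Q.map (QuotientGroup.mk' P) := by
    have := mem_map_of_mem (QuotientGroup.mk' P) hg
    rwa [Subgroup.map_sup, (Subgroup.map_eq_bot_iff P).2 (by simp), bot_sup_eq] at this
  obtain ⟨k, hk⟩ := (hQ.map (QuotientGroup.mk' P)) ⟨_, h1⟩
  refine ⟨k, (QuotientGroup.eq_one_iff _).1 ?_⟩
  simpa using congrArg Subtype.val hk

/-- Frattini argument: the normaliser `Y` of a Sylow `p`-subgroup `P` of `G` still maps onto `G'`.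
Inside `Y` the product of `P` with a Sylow `q`-subgroup is `p`-by-`q` and also maps onto `G'`, hence
is not nilpotent. -/
theorem IsNonnilpotentPByQ.hasSchmidtSubgroup_of_surjective {p q : ℕ} {G G' : Type*} [Group G]
    [Group G'] [Finite G] (h : IsNonnilpotentPByQ p q G') (f : G →* G')
    (hf : Function.Surjective f) : HasSchmidtSubgroup p q G := by
  obtain ⟨hp, hq, hpq, hn, P', hP', hP1, hQ'⟩ := id h
  have := Finite.of_surjective f hf
  have := Fact.mk hp
  have := Fact.mk hq
  have hP'dvd := not_dvd_index_of_forall_pow_mem hp hq hpq hQ'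
  obtain ⟨P⟩ : Nonempty (Sylow p G) := inferInstance
  -- `P'` is normal of index prime to `p`, hence the only Sylow `p`-subgroup of `G'`.
  have hPmap : (P : Subgroup G).map f = P' := by
    rw [← Sylow.coe_mapSurjective hf P]
    have h1 : P' ≤ P.mapSurjective hf := hP1.le_sylow_of_normal _
    have h2 := (hP1.toSylow hP'dvd).is_maximal' (P.mapSurjective hf).2 (by simpa using h1)
    simpa using h2
  obtain ⟨Y, hYdef⟩ : ∃ Y : Subgroup G, Y = normalizer (P : Set G) := ⟨_, rfl⟩
  have hPY : (P : Subgroup G) ≤ Y := hYdef ▸ le_normalizer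
  have hY : Y.map f = ⊤ := by
    have h1 : Y ⊔ P'.comap f = ⊤ := hYdef ▸
      P.normalizer_sup_eq_top' (by rw [← map_le_iff_le_comap, hPmap])
    have h2 := congrArg (Subgroup.map f) h1
    rw [Subgroup.map_sup, Subgroup.map_comap_eq_self_of_surjective hf,
      Subgroup.map_top_of_surjective f hf] at h2
    rwa [sup_eq_left.2 (hPmap ▸ Subgroup.map_mono hPY)] at h2
  have hfY : Function.Surjective (f.comp Y.subtype) := by
    rw [← MonoidHom.range_eq_top, MonoidHom.range_comp, Subgroup.range_subtype, hY]
  obtain ⟨PY, hPYdef⟩ : ∃ PY : Subgroup Y, PY = (P : Subgroup G).subgroupOf Y := ⟨_, rfl⟩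
  have hPYn : PY.Normal := by
    rw [hPYdef, hYdef]; exact Subgroup.normal_in_normalizer
  have hPYmap : PY.map (f.comp Y.subtype) = P' := by
    rw [← Subgroup.map_map, hPYdef, Subgroup.map_subgroupOf_eq_of_le hPY, hPmap]
  have hPYp : IsPGroup p PY := hPYdef ▸ P.2.comap_subtype
  obtain ⟨Q⟩ : Nonempty (Sylow q Y) := inferInstance
  obtain ⟨T, hT⟩ : ∃ T : Subgroup Y, T = PY ⊔ Q := ⟨_, rfl⟩
  have hTmap : T.map (f.comp Y.subtype) = ⊤ := by
    rw [hT, Subgroup.map_sup, hPYmap, ← Sylow.coe_mapSurjective hfY Q,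
      ← Subgroup.index_eq_one]
    -- The image contains Sylow subgroups for `p` and `q`, the only possible prime divisors of
    -- `|G'|`, so no prime divides its index.
    by_contra hne
    obtain ⟨r, hr, hrd⟩ := Nat.exists_prime_and_dvd hne
    have h1 := hrd.trans (Subgroup.index_dvd_of_le
      (le_sup_left : P' ≤ P' ⊔ (Q.mapSurjective hfY : Subgroup G')))
    have h2 := hrd.trans (Subgroup.index_dvd_of_le
      (le_sup_right : (Q.mapSurjective hfY : Subgroup G') ≤ P' ⊔ Q.mapSurjective hfY))
    rcases mem_primeDivisors_of_isPGroup_by hp hq hP1 hQ'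
      (r := r) ⟨hr, h1.trans (Subgroup.index_dvd_card _)⟩ with rfl | rfl
    · exact hP'dvd h1
    · exact (Q.mapSurjective hfY).not_dvd_index h2
  have hTn : ¬ Group.IsNilpotent T := by
    refine not_isNilpotent_of_surjective ((f.comp Y.subtype).comp T.subtype) ?_ hn
    rw [← MonoidHom.range_eq_top, MonoidHom.range_comp, Subgroup.range_subtype, hTmap]
  have hPQ : IsNonnilpotentPByQ p q T := by
    refine ⟨hp, hq, hpq, hTn, PY.subgroupOf T, inferInstance, hPYp.comap_subtype, fun g => ?_⟩
    obtain ⟨k, hk⟩ := exists_pow_mem_of_mem_sup (P := PY) Q.2 (by rw [← hT]; exact g.2)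
    exact ⟨k, hk⟩
  exact hPQ.hasSchmidtSubgroup (Y.subtype.comp T.subtype)
    (Y.subtype_injective.comp T.subtype_injective)

theorem HasSchmidtSubgroup.of_surjective {p q : ℕ} {G G' : Type*} [Group G] [Group G']
    [Finite G] (h : HasSchmidtSubgroup p q G') (f : G →* G') (hf : Function.Surjective f) :
    HasSchmidtSubgroup p q G := by
  have := Finite.of_surjective f hf
  obtain ⟨H, hH⟩ := hasSchmidtSubgroup_iff.1 h
  exact (hH.hasSchmidtSubgroup_of_surjective _
    (f.subgroupComap_surjective_of_surjective H hf)).of_injective _ (subtype_injective _)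

/-! ### Closure properties of the Schmidt graph -/

theorem schmidtGraph_le_of_injective {G H : Type*} [Group G] [Finite G] [Group H] [Finite H]
    (f : H →* G) (hf : Function.Injective f) : schmidtGraph H ≤ schmidtGraph G :=
  ⟨fun _ hr => ⟨hr.1, hr.2.trans (Subgroup.card_dvd_of_injective f hf)⟩,
    fun _ he => HasSchmidtSubgroup.of_injective he f hf⟩

theorem schmidtGraph_le_of_surjective {G H : Type*} [Group G] [Finite G] [Group H] [Finite H]
    (f : G →* H) (hf : Function.Surjective f) : schmidtGraph H ≤ schmidtGraph G :=
  ⟨fun _ hr => ⟨hr.1, hr.2.trans (Subgroup.card_dvd_of_surjective f hf)⟩,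
    fun _ he => HasSchmidtSubgroup.of_surjective he f hf⟩

theorem NatDigraph.le_antisymm {Γ₁ Γ₂ : NatDigraph} (h : Γ₁ ≤ Γ₂) (h' : Γ₂ ≤ Γ₁) : Γ₁ = Γ₂ :=
  NatDigraph.ext (h.1.antisymm h'.1) (h.2.antisymm h'.2)

theorem NatDigraph.union_le {ι : Type*} {Γ : ι → NatDigraph} {Γ' : NatDigraph}
    (h : ∀ i, Γ i ≤ Γ') : NatDigraph.union Γ ≤ Γ' :=
  ⟨Set.iUnion_subset fun i => (h i).1, Set.iUnion_subset fun i => (h i).2⟩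

theorem schmidtGraph_eq_of_mulEquiv {G : Type*} {H : Type*} [Group G] [Finite G] [Group H]
    [Finite H] (e : G ≃* H) : schmidtGraph G = schmidtGraph H :=
  NatDigraph.le_antisymm (schmidtGraph_le_of_injective e.toMonoidHom e.injective)
    (schmidtGraph_le_of_surjective e.toMonoidHom e.surjective)

theorem schmidtGraph_isArithmetic : schmidtGraph.{u}.IsArithmetic := by
  refine ⟨fun G _ _ r hr => hr.2, fun G _ _ hG => ?_⟩
  have hv : (schmidtGraph G).verts = ∅ := by
    refine Set.eq_empty_of_forall_notMem fun r hr => hr.1.one_lt.ne' ?_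
    have h1 : r ∣ Nat.card G := hr.2
    rwa [Nat.card_of_subsingleton (1 : G), Nat.dvd_one] at h1
  refine NatDigraph.ext hv (Set.eq_empty_of_forall_notMem fun e he => ?_)
  have := ((schmidtGraph G).edges_subset he).1
  rw [hv] at this
  exact this

/-- A subgroup of the product embeds in the product of its projections, so a non-nilpotent one has a
non-nilpotent projection, which is again `p`-by-`q`. -/
theorem schmidtGraph_pi {ι : Type*} [Finite ι] (G : ι → Type*) [∀ i, Group (G i)]
    [∀ i, Finite (G i)] :
    schmidtGraph ((i : ι) → G i) = NatDigraph.union fun i => schmidtGraph (G i) := by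
  classical
  have := Fintype.ofFinite ι
  refine NatDigraph.le_antisymm ⟨fun r hr => ?_, fun e he => ?_⟩
    (NatDigraph.union_le fun i => schmidtGraph_le_of_surjective (Pi.evalMonoidHom G i)
      (Function.surjective_eval i))
  · obtain ⟨hr, hd⟩ := hr
    rw [Nat.card_pi] at hd
    obtain ⟨i, -, hi⟩ := (Prime.dvd_finsetProd_iff hr.prime _).1 hd
    exact Set.mem_iUnion.2 ⟨i, hr, hi⟩
  · obtain ⟨H, hH⟩ := hasSchmidtSubgroup_iff.1 he
    suffices ∃ i, HasSchmidtSubgroup e.1 e.2 (G i) by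
      obtain ⟨i, hi⟩ := this
      exact Set.mem_iUnion.2 ⟨i, hi⟩
    by_contra! hcon
    let f : (i : ι) → H →* G i := fun i => (Pi.evalMonoidHom G i).comp H.subtype
    have hnil : ∀ i, Group.IsNilpotent (f i).range := by
      intro i
      by_contra hn
      exact hcon i ((hH.of_surjective (f i).rangeRestrict
        (f i).rangeRestrict_surjective hn).hasSchmidtSubgroup _ (subtype_injective _))
    refine not_isNilpotent_of_injective (MonoidHom.pi fun i => (f i).rangeRestrict)
      (fun x y hxy => Subtype.ext (funext fun i => ?_)) hH.not_nilpotent inferInstance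
    exact congrArg Subtype.val (congrFun hxy i)

theorem schmidtGraph_r0Closed : schmidtGraph.{u}.R0Closed := by
  intro G _ _ n N hN
  have hN' : (⨅ i, N i).Normal := Subgroup.normal_iInf_normal hN
  refine NatDigraph.le_antisymm (NatDigraph.union_le fun i => ?_) ?_
  · exact schmidtGraph_le_of_surjective
      (QuotientGroup.map _ (N i) (MonoidHom.id G) (iInf_le N i))
      (fun x => by
        obtain ⟨x, rfl⟩ := QuotientGroup.mk_surjective x
        exact ⟨(x : G ⧸ ⨅ i, N i), rfl⟩)
  · rw [← schmidtGraph_pi]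
    refine schmidtGraph_le_of_injective
      (MonoidHom.pi fun i => QuotientGroup.map _ (N i) (MonoidHom.id G) (iInf_le N i)) ?_
    rw [injective_iff_map_eq_one]
    intro x hx
    obtain ⟨x, rfl⟩ := QuotientGroup.mk_surjective x
    refine (QuotientGroup.eq_one_iff _).2 (Subgroup.mem_iInf.2 fun i => ?_)
    exact (QuotientGroup.eq_one_iff _).1 (congrFun hx i)

theorem schmidtGraph_sClosed : schmidtGraph.{u}.SClosed := fun _ _ _ H =>
  schmidtGraph_le_of_injective H.subtype H.subtype_injective

theorem schmidtGraph_qClosed : schmidtGraph.{u}.QClosed := fun _ _ _ N _ =>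
  schmidtGraph_le_of_surjective (QuotientGroup.mk' N) (QuotientGroup.mk'_surjective N)

theorem schmidtGraph_d0Closed : schmidtGraph.{u}.D0Closed := fun _ G _ _ => schmidtGraph_pi G

/-! ### The deleted permutation module of `A₅` over `𝔽₃` -/

/-- The vectors of `𝔽₃⁵` with coordinate sum zero. -/
abbrev SumZero : Type :=
  LinearMap.ker (∑ i, LinearMap.proj i : (Fin 5 → ZMod 3) →ₗ[ZMod 3] ZMod 3)

theorem sumZero_mem {v : Fin 5 → ZMod 3} :
    v ∈ LinearMap.ker (∑ i, LinearMap.proj i : (Fin 5 → ZMod 3) →ₗ[ZMod 3] ZMod 3) ↔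
      ∑ i, v i = 0 := by
  simp [LinearMap.mem_ker]

theorem SumZero.sum_eq_zero (v : SumZero) : ∑ i, v.1 i = 0 := sumZero_mem.1 v.2

/-- The action of `A₅` on `SumZero` by permutation of the coordinates. -/
def sumZeroRep : Representation (ZMod 3) (alternatingGroup (Fin 5)) SumZero where
  toFun σ :=
    { toFun := fun v => ⟨fun i => v.1 (σ.1⁻¹ i), sumZero_mem.2 (by
        rw [Equiv.sum_comp σ.1⁻¹ v.1]; exact v.sum_eq_zero)⟩
      map_add' := fun _ _ => rfl
      map_smul' := fun _ _ => rfl }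
  map_one' := rfl
  map_mul' _ _ := rfl

theorem sumZeroRep_apply (σ : alternatingGroup (Fin 5)) (v : SumZero) (i : Fin 5) :
    (sumZeroRep σ v).1 (σ.1 i) = v.1 i := by
  change v.1 (σ.1⁻¹ (σ.1 i)) = v.1 i
  simp

/-- The fiveCycle `i ↦ i + 1` of five points. -/
def fiveCycle : alternatingGroup (Fin 5) := ⟨finRotate 5, by
  rw [Equiv.Perm.mem_alternatingGroup]; decide⟩

theorem fiveCycle_pow_five : fiveCycle ^ 5 = 1 := by
  apply Subtype.ext; decide

theorem fiveCycle_apply (i : Fin 5) : fiveCycle.1 i = i + 1 := finRotate_apply i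

/-- A fixed vector is constant, and 5 is invertible modulo 3. -/
theorem eq_zero_of_fiveCycle_fixed {v : SumZero} (h : sumZeroRep fiveCycle v = v) : v = 0 := by
  have h1 : ∀ i, v.1 (i + 1) = v.1 i := fun i => by
    rw [← fiveCycle_apply, ← sumZeroRep_apply fiveCycle v i, h]
  have h2 := v.sum_eq_zero
  have e1 : v.1 1 = v.1 0 := h1 0
  have e2 : v.1 2 = v.1 1 := h1 1
  have e3 : v.1 3 = v.1 2 := h1 2
  have e4 : v.1 4 = v.1 3 := h1 3
  have h0 : v.1 0 = 0 := by
    rw [Fin.sum_univ_five, e4, e3, e2, e1] at h2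
    revert h2
    generalize v.1 0 = x
    revert x
    decide
  refine Subtype.ext (funext fun i => ?_)
  fin_cases i
  exacts [h0, e1.trans h0, (e2.trans e1).trans h0, (e3.trans (e2.trans e1)).trans h0,
    (e4.trans (e3.trans (e2.trans e1))).trans h0]

/-- Only 0 is fixed, so counting orbits gives `|B| ≡ 1` modulo 5. As `|B|` divides `3⁵` and 3 has
order 4 modulo 5, only `3⁰` and `3⁴` remain. -/
theorem card_eq_of_fiveCycle_stable (B : AddSubgroup SumZero)
    (hB : ∀ v ∈ B, sumZeroRep fiveCycle v ∈ B) : Nat.card B = 1 ∨ Nat.card B = 81 := by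
  classical
  have := Fintype.ofFinite B
  let f : Function.End B := fun v => ⟨sumZeroRep fiveCycle v, hB v v.2⟩
  have hf : f ^ 5 ^ 1 = 1 := by
    funext v
    have h1 : ∀ n : ℕ, ((f ^ n) v : B).1 = sumZeroRep (fiveCycle ^ n) v.1 := by
      intro n
      induction n with
      | zero => rw [pow_zero, pow_zero, map_one]; rfl
      | succ n ih =>
        rw [pow_succ', pow_succ', map_mul]
        exact congrArg (sumZeroRep fiveCycle) ih
    refine Subtype.ext ?_
    rw [pow_one, h1, fiveCycle_pow_five, map_one]
    rfl
  have : Fact (Nat.Prime 5) := ⟨by norm_num⟩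
  have h1 := Equiv.Perm.card_fixedPoints_modEq (p := 5) (n := 1) hf
  have h2 : Fintype.card f.fixedPoints = 1 := by
    refine Fintype.card_eq_one_iff.2 ⟨⟨0, Subtype.ext (map_zero (sumZeroRep fiveCycle))⟩, ?_⟩
    rintro ⟨x, hx⟩
    exact Subtype.ext (Subtype.ext (eq_zero_of_fiveCycle_fixed (congrArg Subtype.val hx)))
  rw [h2, ← Nat.card_eq_fintype_card] at h1
  have h3 : Nat.card B ∣ 3 ^ 5 := by
    have h4 : Nat.card SumZero ∣ Nat.card (Fin 5 → ZMod 3) :=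
      AddSubgroup.card_addSubgroup_dvd_card (Submodule.toAddSubgroup
        (LinearMap.ker (∑ i, LinearMap.proj i : (Fin 5 → ZMod 3) →ₗ[ZMod 3] ZMod 3)))
    have h5 := (AddSubgroup.card_addSubgroup_dvd_card B).trans h4
    rwa [Nat.card_fun, Nat.card_zmod, Nat.card_fin] at h5
  obtain ⟨k, hk, hk'⟩ := (Nat.dvd_prime_pow Nat.prime_three).1 h3
  rw [hk'] at h1 ⊢
  interval_cases k <;> simp_all [Nat.ModEq]

/-- The vector `e₀ - e₁`. -/
def firstDifference : SumZero := ⟨![1, -1, 0, 0, 0], sumZero_mem.2 (by decide)⟩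

instance : Nontrivial SumZero :=
  ⟨⟨firstDifference, 0, fun h => absurd (congrFun (congrArg Subtype.val h) 0)
    (by change ¬ (1 : ZMod 3) = 0; decide)⟩⟩

theorem eq_bot_or_eq_top_of_fiveCycle_stable (B : AddSubgroup SumZero)
    (hB : ∀ v ∈ B, sumZeroRep fiveCycle v ∈ B) : B = ⊥ ∨ B = ⊤ := by
  have h81 : Nat.card SumZero = 81 := by
    rw [← AddSubgroup.card_top]
    refine (card_eq_of_fiveCycle_stable ⊤ fun _ _ => trivial).resolve_left fun h => ?_
    rw [AddSubgroup.card_top] at h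
    exact (Finite.one_lt_card (α := SumZero)).ne' h
  rcases card_eq_of_fiveCycle_stable B hB with h | h
  · exact Or.inl (AddSubgroup.eq_bot_of_card_eq _ h)
  · exact Or.inr (AddSubgroup.eq_top_of_card_eq _ (h.trans h81.symm))

theorem sumZeroRep_isIrreducible : sumZeroRep.IsIrreducible where
  exists_pair_ne := ⟨⊥, ⊤, fun h => by
    have h1 : firstDifference ∈ (⊥ : Subrepresentation sumZeroRep) := h ▸ trivial
    have h2 : firstDifference = 0 := h1
    exact absurd (congrFun (congrArg Subtype.val h2) 0)
      (by change ¬ (1 : ZMod 3) = 0; decide)⟩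
  eq_bot_or_eq_top W := by
    refine (eq_bot_or_eq_top_of_fiveCycle_stable W.toSubmodule.toAddSubgroup
      (fun v hv => W.apply_mem_toSubmodule fiveCycle hv)).imp (fun h => ?_) (fun h => ?_)
    · refine Subrepresentation.toSubmodule_injective (Submodule.toAddSubgroup_injective ?_)
      exact h
    · refine Subrepresentation.toSubmodule_injective (Submodule.toAddSubgroup_injective ?_)
      exact h

/-- `A₅` is simple and the 5-cycle acts nontrivially. -/
theorem sumZeroRep_injective : Function.Injective sumZeroRep := by
  have hk := (inferInstance : (sumZeroRep.ker).Normal).eq_bot_or_eq_top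
  rw [← MonoidHom.ker_eq_bot_iff]
  refine hk.resolve_right fun h => ?_
  have h1 : fiveCycle ∈ sumZeroRep.ker := h ▸ Subgroup.mem_top _
  have h2 : sumZeroRep fiveCycle firstDifference = firstDifference := by
    rw [MonoidHom.mem_ker.1 h1]; rfl
  exact absurd (congrFun (congrArg Subtype.val (eq_zero_of_fiveCycle_fixed h2)) 0)
    (by change ¬ (1 : ZMod 3) = 0; decide)

theorem exists_fiveCycle_sub_eq (v : SumZero) : ∃ w, sumZeroRep fiveCycle w - w = v := by
  have hinj : Function.Injective (sumZeroRep fiveCycle - 1 : SumZero →ₗ[ZMod 3] SumZero) := by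
    rw [← LinearMap.ker_eq_bot, LinearMap.ker_eq_bot']
    intro w hw
    exact eq_zero_of_fiveCycle_fixed (sub_eq_zero.1 hw)
  exact Finite.surjective_of_injective hinj v

/-! ### A nonsplit extension of `A₅` by the deleted permutation module -/

/-- For distinct `i, a, b`, the pairing of the complement of `i` in which `a` and `b` are partners,
labelled so that `A₅` preserves the cyclic order of the three pairings of each complement. -/
def pairingLabel (i a b : Fin 5) : ZMod 3 :=
  -- Modulo 5, both pairs of `{1,2},{3,4}` have product 2 and both of `{1,3},{2,4}` have product 3;
  -- the pairs of `{1,4},{2,3}` have products 4 and 1.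
  if (a - i) * (b - i) = 2 then 1 else if (a - i) * (b - i) = 3 then 2 else 0

/-- The amount by which `σ` shifts the labels of the pairings of the complement of `i`. -/
def labelShift (σ : Equiv.Perm (Fin 5)) (i : Fin 5) : ZMod 3 :=
  -- The reference pair `i + 1, i + 2` has label 1.
  pairingLabel (σ i) (σ (i + 1)) (σ (i + 2)) - 1

-- Labels are translation invariant, and even permutations fixing `i` rotate the three pairings;
-- these two kinds of permutation generate `A₅`. Independence of the pair `a, b` yields the cocycle
-- identity for `labelShift`.
set_option maxRecDepth 100000 in
theorem pairingLabel_map_sub : ∀ σ : Equiv.Perm (Fin 5), Equiv.Perm.sign σ = 1 →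
    ∀ i a b : Fin 5, a ≠ i → b ≠ i → a ≠ b →
      pairingLabel (σ i) (σ a) (σ b) - pairingLabel i a b = labelShift σ i := by decide

-- By the cocycle identity the sum is a homomorphism from the perfect group `A₅` to `ℤ/3`.
set_option maxRecDepth 100000 in
theorem sum_labelShift : ∀ σ : Equiv.Perm (Fin 5), Equiv.Perm.sign σ = 1 →
    ∑ i, labelShift σ i = 0 := by decide

/-- The wreath product of a cyclic group of order nine with `A₅`. -/
abbrev Wreath : Type :=
  (Fin 5 → Multiplicative (ZMod 9)) ⋊[mulAutArrow] alternatingGroup (Fin 5)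

/-- The coordinate of an element of the base group, at the image of `i`. -/
def Wreath.coord (x : Wreath) (i : Fin 5) : ZMod 9 :=
  Multiplicative.toAdd (x.left (x.right.1 i))

theorem Wreath.coord_one (i : Fin 5) : (1 : Wreath).coord i = 0 := rfl

/-- Indexing by the source point turns multiplication into the cocycle rule obeyed by `labelShift`.
-/
theorem Wreath.coord_mul (x y : Wreath) (i : Fin 5) :
    (x * y).coord i = x.coord (y.right.1 i) + y.coord i := by
  have h : (x * y).left (x.right.1 (y.right.1 i)) =
      x.left (x.right.1 (y.right.1 i)) * y.left (x.right.1⁻¹ (x.right.1 (y.right.1 i))) := rfl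
  rw [← Equiv.Perm.mul_apply x.right.1⁻¹, inv_mul_cancel, Equiv.Perm.one_apply] at h
  exact congrArg Multiplicative.toAdd h

theorem Wreath.coord_inv (x : Wreath) (i : Fin 5) :
    x⁻¹.coord (x.right.1 i) = - x.coord i := by
  have h := Wreath.coord_mul x⁻¹ x i
  rw [inv_mul_cancel, Wreath.coord_one] at h
  exact eq_neg_of_add_eq_zero_left h.symm

theorem Wreath.ext' {x y : Wreath} (h : x.right = y.right) (hc : ∀ i, x.coord i = y.coord i) :
    x = y := by
  refine SemidirectProduct.ext (funext fun i => ?_) h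
  obtain ⟨j, rfl⟩ := x.right.1.surjective i
  have := hc j
  unfold Wreath.coord at this
  rw [← h] at this
  exact this

/-- Reduction modulo three. -/
abbrev modThree : ZMod 9 →+* ZMod 3 := ZMod.castHom (by norm_num) (ZMod 3)

/-- The elements `x` of the wreath product with coordinate sum zero whose coordinates reduce
modulo three to the shifts of the pairing labels under the permutation of `x`. -/
def frattiniCover : Subgroup Wreath where
  carrier := {x | ∑ i, x.coord i = 0 ∧ ∀ i, modThree (x.coord i) = labelShift x.right.1 i}
  one_mem' := ⟨by simp [Wreath.coord_one], by
    intro i; rw [Wreath.coord_one, map_zero]; revert i; decide⟩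
  mul_mem' := by
    rintro x y ⟨hx, hx'⟩ ⟨hy, hy'⟩
    refine ⟨?_, fun i => ?_⟩
    · simp only [Wreath.coord_mul, Finset.sum_add_distrib, hy,
        Equiv.sum_comp y.right.1 x.coord, hx, add_zero]
    -- The shift by `x` at `y i` is measured on the image under `y` of the reference pair, so that
    -- the two shifts telescope.
    · have h1 := pairingLabel_map_sub x.right.1 x.right.2 (y.right.1 i) (y.right.1 (i + 1))
        (y.right.1 (i + 2)) (by simp) (by simp) (by simp)
      rw [Wreath.coord_mul, map_add, hx', hy', ← h1]
      simp [labelShift]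
  inv_mem' := by
    rintro x ⟨hx, hx'⟩
    refine ⟨?_, fun i => ?_⟩
    · rw [← Equiv.sum_comp x.right.1]
      simp [Wreath.coord_inv, hx]
    · obtain ⟨j, rfl⟩ := x.right.1.surjective i
      have h1 := pairingLabel_map_sub x.right.1⁻¹ (x.right⁻¹).2 (x.right.1 j)
        (x.right.1 (j + 1)) (x.right.1 (j + 2)) (by simp) (by simp) (by simp)
      rw [Wreath.coord_inv, map_neg, hx']
      refine Eq.trans ?_ h1
      rw [← pairingLabel_map_sub x.right.1 x.right.2 j (j + 1) (j + 2)
        (by simp) (by simp) (by simp)]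
      simp

/-- Multiplication by three, from `ℤ/3` to `ℤ/9`. -/
def timesThree : ZMod 3 →+ ZMod 9 := AddMonoidHom.mk' (fun x => 3 * (x.val : ZMod 9)) (by decide)

theorem timesThree_injective : Function.Injective timesThree := by decide

theorem modThree_timesThree (x : ZMod 3) : modThree (timesThree x) = 0 := by
  revert x; decide

theorem exists_timesThree_eq {y : ZMod 9} (h : modThree y = 0) : ∃ x, timesThree x = y := by
  revert y; decide

theorem three_mul_ne_zero {y : ZMod 9} (h : modThree y ≠ 0) : y + y + y ≠ 0 := by
  revert y; decide

theorem labelShift_one (i : Fin 5) : labelShift 1 i = 0 := by revert i; decide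

/-- The inclusion of the deleted permutation module into the wreath product. -/
def frattiniCoverInl : Multiplicative SumZero →* frattiniCover where
  toFun v := ⟨⟨fun i => Multiplicative.ofAdd (timesThree ((Multiplicative.toAdd v).1 i)), 1⟩, by
    refine ⟨?_, fun i => ?_⟩
    · change ∑ i, timesThree ((Multiplicative.toAdd v).1 i) = 0
      rw [← map_sum, SumZero.sum_eq_zero, map_zero]
    · exact (modThree_timesThree _).trans (labelShift_one i).symm⟩
  map_one' := by
    refine Subtype.ext (Wreath.ext' rfl fun i => ?_)
    exact map_zero timesThree
  map_mul' v w := by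
    refine Subtype.ext (Wreath.ext' rfl fun i => ?_)
    rw [Subgroup.coe_mul, Wreath.coord_mul]
    exact map_add timesThree _ _

theorem coord_inl (v : SumZero) (i : Fin 5) :
    (frattiniCoverInl (Multiplicative.ofAdd v)).1.coord i = timesThree (v.1 i) := rfl

/-- The extension of `A₅` by the deleted permutation module given by `frattiniCover`. -/
def frattiniCoverExtension :
    GroupExtension (Multiplicative SumZero) frattiniCover (alternatingGroup (Fin 5)) where
  inl := frattiniCoverInl
  rightHom := SemidirectProduct.rightHom.comp frattiniCover.subtype
  inl_injective := by
    intro v w h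
    refine Subtype.ext (funext fun i => timesThree_injective ?_)
    exact congrArg (fun x : frattiniCover => x.1.coord i) h
  range_inl_eq_ker_rightHom := by
    ext x
    constructor
    · rintro ⟨v, rfl⟩
      rfl
    · intro hx
      have hr : x.1.right = 1 := hx
      have h1 : ∀ i, modThree (x.1.coord i) = 0 := fun i => by
        rw [x.2.2 i, hr]; exact labelShift_one i
      choose v hv using fun i => exists_timesThree_eq (h1 i)
      refine ⟨Multiplicative.ofAdd ⟨v, sumZero_mem.2 (timesThree_injective ?_)⟩,
        Subtype.ext (Wreath.ext' hr.symm fun i => ?_)⟩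
      · rw [map_sum, map_zero, ← x.2.1]
        exact Finset.sum_congr rfl fun i _ => hv i
      · exact hv i
  rightHom_surjective := by
    intro σ
    have hlift : ∀ y : ZMod 3, ∃ z : ZMod 9, modThree z = y := by decide
    choose c hc using fun i => hlift (labelShift σ.1 i)
    obtain ⟨d, hd⟩ : ∃ d : Fin 5 → ZMod 9,
        ∑ i, d i = 0 ∧ ∀ i, modThree (d i) = labelShift σ.1 i := by
      -- The sum of arbitrary lifts is divisible by 3, so removing it from one coordinate leaves all
      -- residues modulo 3 unchanged.
      refine ⟨c - Pi.single 0 (∑ i, c i), by simp, fun i => ?_⟩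
      have h0 : modThree (∑ i, c i) = 0 := by
        rw [map_sum]; simp only [hc]; exact sum_labelShift σ.1 σ.2
      rw [Pi.sub_apply, map_sub, hc]
      rcases eq_or_ne i 0 with rfl | hi
      · rw [Pi.single_eq_same, h0, sub_zero]
      · rw [Pi.single_eq_of_ne hi, map_zero, sub_zero]
    let x : Wreath := ⟨fun i => Multiplicative.ofAdd (d (σ.1⁻¹ i)), σ⟩
    have hx : ∀ i, x.coord i = d i := fun i => by
      change d (σ.1⁻¹ (σ.1 i)) = d i
      simp
    exact ⟨⟨x, by simp only [hx]; exact hd.1, fun i => by rw [hx]; exact hd.2 i⟩, rfl⟩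

theorem frattiniCover_conj_inl (r : frattiniCover) (v : SumZero) :
    r * frattiniCoverExtension.inl (Multiplicative.ofAdd v) * r⁻¹ =
      frattiniCoverExtension.inl
        (Multiplicative.ofAdd (sumZeroRep (frattiniCoverExtension.rightHom r) v)) := by
  rw [mul_inv_eq_iff_eq_mul]
  refine Subtype.ext (Wreath.ext' ?_ fun i => ?_)
  · exact (mul_one _).trans (one_mul _).symm
  · refine (Wreath.coord_mul _ _ _).trans (Eq.trans ?_ (Wreath.coord_mul _ _ _).symm)
    have h1 := coord_inl v i
    have h2 := coord_inl (sumZeroRep r.1.right v) (r.1.right.1 i)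
    rw [sumZeroRep_apply] at h2
    exact (congrArg (r.1.coord i + ·) h1).trans ((add_comm _ _).trans
      (congrArg (· + r.1.coord i) h2.symm))

/-! ### The Frattini subgroup of the cover -/

/-- The cycle `(1 2 3)`. -/
def threeCycle : alternatingGroup (Fin 5) :=
  ⟨Equiv.swap 1 2 * Equiv.swap 2 3, by rw [Equiv.Perm.mem_alternatingGroup]; decide⟩

theorem threeCycle_pow_three : threeCycle ^ 3 = 1 := by
  apply Subtype.ext; decide

/-- The 3-cycle fixes 0 and rotates the pairings of its complement. Coordinate 0 of `m` is thus
nonzero modulo 3, and coordinate 0 of `m ^ 3` is three times it, nonzero in `ℤ/9`. -/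
theorem frattiniCover_pow_three_ne_one {m : frattiniCover}
    (hm : frattiniCoverExtension.rightHom m = threeCycle) : m ^ 3 ≠ 1 := by
  intro h
  have hr : m.1.right = threeCycle := hm
  have h0 : m.1.right.1 0 = 0 := by rw [hr]; decide
  have h1 : modThree (m.1.coord 0) ≠ 0 := by rw [m.2.2 0, hr]; decide
  refine three_mul_ne_zero h1 ?_
  have h2 : (m.1 ^ 3).coord 0 = 0 := by
    have : m.1 ^ 3 = 1 := congrArg Subtype.val h
    rw [this]; rfl
  rwa [pow_succ, pow_two, Wreath.coord_mul, Wreath.coord_mul, h0, h0] at h2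

/-- A maximal subgroup `M` not containing `A` would satisfy `MA = R`, making `M ∩ A` stable under
`A₅` and hence trivial. Then the cube of an element of `M` over the 3-cycle would lie in `M ∩ A =
1`. -/
theorem range_inl_le_frattini :
    frattiniCoverExtension.inl.range ≤ frattini frattiniCover := by
  have hnorm : frattiniCoverExtension.inl.range.Normal := by
    rw [frattiniCoverExtension.range_inl_eq_ker_rightHom]; infer_instance
  refine le_iInf₂ fun M (hM : IsCoatom M) => ?_
  by_contra hle
  have hsup : M ⊔ frattiniCoverExtension.inl.range = ⊤ :=
    hM.2 _ (lt_of_le_of_ne le_sup_left fun h => hle (h ▸ le_sup_right))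
  have hsurj : ∀ σ, ∃ m ∈ M, frattiniCoverExtension.rightHom m = σ := by
    intro σ
    obtain ⟨r, rfl⟩ := frattiniCoverExtension.rightHom_surjective σ
    have hr : r ∈ M ⊔ frattiniCoverExtension.inl.range := hsup ▸ Subgroup.mem_top r
    obtain ⟨m, hm, _, ⟨v, rfl⟩, rfl⟩ := Subgroup.mem_sup_of_normal_right.1 hr
    exact ⟨m, hm, by rw [map_mul, frattiniCoverExtension.rightHom_inl, mul_one]⟩
  let B : AddSubgroup SumZero := Subgroup.toAddSubgroup' (M.comap frattiniCoverExtension.inl)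
  have hBmem : ∀ v, v ∈ B ↔ frattiniCoverExtension.inl (Multiplicative.ofAdd v) ∈ M :=
    fun v => Iff.rfl
  have hB : ∀ v ∈ B, sumZeroRep fiveCycle v ∈ B := by
    intro v hv
    obtain ⟨m, hm, hm'⟩ := hsurj fiveCycle
    rw [hBmem, ← hm', ← frattiniCover_conj_inl]
    exact M.mul_mem (M.mul_mem hm hv) (M.inv_mem hm)
  rcases eq_bot_or_eq_top_of_fiveCycle_stable B hB with h | h
  · obtain ⟨m, hm, hm'⟩ := hsurj threeCycle
    have h3 : m ^ 3 ∈ frattiniCoverExtension.inl.range := by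
      rw [frattiniCoverExtension.range_inl_eq_ker_rightHom, MonoidHom.mem_ker, map_pow, hm',
        threeCycle_pow_three]
    obtain ⟨v, hv⟩ := h3
    have hvB : Multiplicative.toAdd v ∈ B := by
      rw [hBmem, ofAdd_toAdd, hv]
      exact M.pow_mem hm 3
    rw [h, AddSubgroup.mem_bot] at hvB
    have hv1 : v = 1 := hvB
    exact frattiniCover_pow_three_ne_one hm' (by rw [← hv, hv1, map_one])
  · refine hle ?_
    rintro _ ⟨v, rfl⟩
    have : Multiplicative.toAdd v ∈ B := h ▸ AddSubgroup.mem_top _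
    exact this

instance : Finite Wreath :=
  Finite.of_injective (fun x : Wreath => (x.left, x.right)) fun _ _ h =>
    SemidirectProduct.ext (congrArg Prod.fst h) (congrArg Prod.snd h)

/-- The image of `Φ(R)` in the simple group `A₅` is trivial or everything. In the latter case `Φ(R)
= R`, impossible for a nontrivial finite group by the non-generating property. -/
theorem range_inl_eq_frattini : frattiniCoverExtension.inl.range = frattini frattiniCover := by
  refine le_antisymm range_inl_le_frattini ?_
  rw [frattiniCoverExtension.range_inl_eq_ker_rightHom]
  have hn : ((frattini frattiniCover).map frattiniCoverExtension.rightHom).Normal :=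
    Subgroup.Normal.map inferInstance _ frattiniCoverExtension.rightHom_surjective
  rcases hn.eq_bot_or_eq_top with h | h
  · exact (Subgroup.map_eq_bot_iff _).1 h
  · have h1 : frattini frattiniCover = ⊤ := by
      have h2 : (⊤ : Subgroup frattiniCover) ≤
          frattini frattiniCover ⊔ frattiniCoverExtension.rightHom.ker := by
        rw [← Subgroup.comap_map_eq, h, Subgroup.comap_top]
      rw [← frattiniCoverExtension.range_inl_eq_ker_rightHom,
        sup_eq_left.2 range_inl_le_frattini] at h2
      exact top_le_iff.1 h2
    have h3 : (⊥ : Subgroup frattiniCover) = ⊤ := frattini_nongenerating (by rw [h1, sup_top_eq])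
    have h4 : frattiniCoverExtension.inl (Multiplicative.ofAdd firstDifference) ∈
        (⊥ : Subgroup frattiniCover) := h3 ▸ Subgroup.mem_top _
    rw [Subgroup.mem_bot, ← map_one frattiniCoverExtension.inl] at h4
    exact absurd (congrFun (congrArg Subtype.val (frattiniCoverExtension.inl_injective h4)) 0)
      (by change ¬ (1 : ZMod 3) = 0; decide)

/-- The quotient of `frattiniCover` by its Frattini subgroup is `A₅`. -/
noncomputable def frattiniCoverQuotientEquiv :
    frattiniCover ⧸ frattini frattiniCover ≃* alternatingGroup (Fin 5) :=
  (QuotientGroup.quotientMulEquivOfEq (range_inl_eq_frattini.symm.trans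
    frattiniCoverExtension.range_inl_eq_ker_rightHom)).trans
    (QuotientGroup.quotientKerEquivOfSurjective _ frattiniCoverExtension.rightHom_surjective)

/-! ### Schmidt `(3, 5)`-subgroups of the cover and of `A₅` -/

theorem hasSchmidtSubgroup_frattiniCover : HasSchmidtSubgroup 3 5 frattiniCover := by
  let H : Subgroup frattiniCover := (zpowers fiveCycle).comap frattiniCoverExtension.rightHom
  have hinl : ∀ v, frattiniCoverExtension.inl v ∈ H := fun v => by
    rw [Subgroup.mem_comap, frattiniCoverExtension.rightHom_inl]; exact one_mem _
  obtain ⟨r, hr⟩ := frattiniCoverExtension.rightHom_surjective fiveCycle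
  have hrH : r ∈ H := by
    rw [Subgroup.mem_comap, hr]; exact mem_zpowers _
  refine hasSchmidtSubgroup_iff.2 ⟨H, Nat.prime_three, Nat.prime_five, by norm_num, ?_, ?_⟩
  · rw [Subgroup.nilpotent_iff_lowerCentralSeries]
    rintro ⟨n, hn⟩
    -- Since `fiveCycle - 1` is onto `A`, every element of `A` is a commutator `[r, w]` with `w ∈
    -- A`, so `A` lies in every term of the lower central series.
    have key : ∀ n v, (⟨_, hinl (Multiplicative.ofAdd v)⟩ : H) ∈
        Subgroup.lowerCentralSeries (⊤ : Subgroup H) n := by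
      intro n
      induction n with
      | zero => exact fun v => Subgroup.mem_top _
      | succ n ih =>
        intro v
        obtain ⟨w, rfl⟩ := exists_fiveCycle_sub_eq v
        rw [Subgroup.lowerCentralSeries_succ, Subgroup.commutator_comm]
        have := Subgroup.commutator_mem_commutator (Subgroup.mem_top (⟨r, hrH⟩ : H)) (ih w)
        convert this using 1
        refine Subtype.ext ?_
        change _ = r * _ * r⁻¹ * _⁻¹
        rw [frattiniCover_conj_inl, hr]
        exact (map_div frattiniCoverExtension.inl (Multiplicative.ofAdd (sumZeroRep fiveCycle w))
          (Multiplicative.ofAdd w)).trans (div_eq_mul_inv _ _)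
    have h1 := key n firstDifference
    rw [hn, Subgroup.mem_bot] at h1
    have h2 : frattiniCoverExtension.inl (Multiplicative.ofAdd firstDifference) = 1 :=
      congrArg Subtype.val h1
    rw [← map_one frattiniCoverExtension.inl] at h2
    exact absurd (congrFun (congrArg Subtype.val (frattiniCoverExtension.inl_injective h2)) 0)
      (by change ¬ (1 : ZMod 3) = 0; decide)
  · refine ⟨frattiniCoverExtension.inl.range.subgroupOf H, ?_, ?_, fun g => ⟨1, ?_⟩⟩
    · rw [frattiniCoverExtension.range_inl_eq_ker_rightHom]; infer_instance
    · refine IsPGroup.comap_subtype ?_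
      rintro ⟨_, v, rfl⟩
      refine ⟨1, Subtype.ext ?_⟩
      change frattiniCoverExtension.inl v ^ 3 ^ 1 = 1
      rw [← map_pow, ← map_one frattiniCoverExtension.inl]
      congr 1
      refine Subtype.ext (funext fun i => ?_)
      change (3 ^ 1) • (Multiplicative.toAdd v).1 i = 0
      generalize (Multiplicative.toAdd v).1 i = y
      revert y
      decide
    · rw [Subgroup.mem_subgroupOf, frattiniCoverExtension.range_inl_eq_ker_rightHom,
        MonoidHom.mem_ker]
      obtain ⟨k, hk⟩ := Subgroup.mem_zpowers_iff.1 g.2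
      change frattiniCoverExtension.rightHom (g.1 ^ 5 ^ 1) = 1
      rw [map_pow, ← hk, pow_one, ← zpow_natCast, zpow_comm, zpow_natCast, fiveCycle_pow_five,
        one_zpow]

/-- Among the divisors of 15 only 1 is congruent to 1 modulo 3, and likewise modulo 5, so all Sylow
subgroups are normal. -/
theorem isNilpotent_of_card_eq_fifteen {G : Type*} [Group G] [Finite G] (hG : Nat.card G = 15) :
    Group.IsNilpotent G := by
  refine (Group.isNilpotent_of_finite_tfae.out 0 3 rfl rfl).2 fun p hp P => ?_
  rcases eq_or_ne (P : Subgroup G) ⊥ with h | h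
  · rw [h]; infer_instance
  have hdvd : p ∣ 15 := by
    by_contra hd
    refine h (Subgroup.eq_bot_of_card_eq _ ?_)
    rw [P.card_eq_multiplicity, hG, Nat.factorization_eq_zero_of_not_dvd hd, pow_zero]
  have hp' : p = 3 ∨ p = 5 := by
    have : p ∣ 3 * 5 := hdvd
    exact (hp.out.dvd_mul.1 this).imp (Nat.prime_dvd_prime_iff_eq hp.out Nat.prime_three).1
      (Nat.prime_dvd_prime_iff_eq hp.out Nat.prime_five).1
  have h1 := card_sylow_modEq_one p G
  have h2 := P.card_dvd_index
  have h3 := (P : Subgroup G).card_mul_index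
  rw [P.card_eq_multiplicity, hG] at h3
  have h4 : Nat.card (Sylow p G) = 1 := by
    have h5 : Nat.card (Sylow p G) ∣ 15 := h2.trans ⟨_, (h3.symm.trans (mul_comm _ _))⟩
    have h6 : Nat.card (Sylow p G) ∈ Nat.divisors 15 := Nat.mem_divisors.2 ⟨h5, by norm_num⟩
    have h7 : Nat.divisors 15 = {1, 3, 5, 15} := by decide
    rw [h7] at h6
    have h8 := not_dvd_card_sylow p G
    rcases hp' with rfl | rfl <;> simp only [Finset.mem_insert, Finset.mem_singleton] at h6 <;>
      rcases h6 with h6 | h6 | h6 | h6 <;> rw [h6] at h1 h8 ⊢ <;>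
      revert h1 h8 <;> decide
  have : Subsingleton (Sylow p G) := (Nat.card_eq_one_iff_unique.1 h4).1
  exact P.normal_of_subsingleton

/-- The order of such a subgroup would be an odd multiple of 15 dividing 60. -/
theorem not_hasSchmidtSubgroup_alternatingGroup :
    ¬ HasSchmidtSubgroup 3 5 (alternatingGroup (Fin 5)) := by
  rintro ⟨H, ⟨hn, -⟩, hπ, -⟩
  have hd : Nat.card H ∣ 60 := by
    have := Subgroup.card_subgroup_dvd_card H
    rwa [nat_card_alternatingGroup, Nat.card_fin] at this
  have h3 : 3 ∈ primeDivisors H := by rw [hπ]; simp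
  have h5 : 5 ∈ primeDivisors H := by rw [hπ]; simp
  have h2 : ¬ 2 ∣ Nat.card H := fun h => by
    have : 2 ∈ primeDivisors H := ⟨Nat.prime_two, h⟩
    rw [hπ] at this
    simp at this
  refine hn (isNilpotent_of_card_eq_fifteen ?_)
  have h15 : 15 ∣ Nat.card H := Nat.Coprime.mul_dvd_of_dvd_of_dvd (by norm_num) h3.2 h5.2
  have hle := Nat.le_of_dvd (by norm_num) hd
  obtain ⟨k, hk⟩ := h15
  rw [hk] at hd h2 hle ⊢
  have : k ≤ 4 := by omega
  interval_cases k <;> omega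

theorem schmidtGraph_not_ePhiClosed : ¬ schmidtGraph.{u}.EPhiClosed := by
  intro h
  have h1 := h (ULift.{u} frattiniCover)
  have e : ULift.{u} frattiniCover ≃* frattiniCover := MulEquiv.ulift
  -- The Frattini subgroup is the radical of the subgroup lattice, so it is carried along by lattice
  -- isomorphisms.
  have h2 : (frattini (ULift.{u} frattiniCover)).map e.toMonoidHom = frattini frattiniCover :=
    OrderIso.map_radical e.mapSubgroup
  have e2 := QuotientGroup.congr _ _ e h2
  rw [schmidtGraph_eq_of_mulEquiv e, schmidtGraph_eq_of_mulEquiv e2,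
    schmidtGraph_eq_of_mulEquiv frattiniCoverQuotientEquiv] at h1
  have h3 : ((3, 5) : ℕ × ℕ) ∈ (schmidtGraph frattiniCover).edges :=
    hasSchmidtSubgroup_frattiniCover
  rw [← h1] at h3
  exact not_hasSchmidtSubgroup_alternatingGroup h3

theorem proposition3p3 :
    (schmidtGraph.{u}.IsArithmetic ∧ schmidtGraph.{u}.SClosed ∧ schmidtGraph.{u}.QClosed ∧
      schmidtGraph.{u}.D0Closed ∧ schmidtGraph.{u}.R0Closed) ∧
    ¬ schmidtGraph.{u}.EPhiClosed ∧
    -- the counterexample: a Frattini extension `A ↣ R ↠ A₅`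
    ∃ (A : Type) (_ : AddCommGroup A) (_ : Module (ZMod 3) A)
      (ρ : Representation (ZMod 3) (alternatingGroup (Fin 5)) A)
      (R : Type) (_ : Group R) (_ : Finite R)
      (S : GroupExtension (Multiplicative A) R (alternatingGroup (Fin 5))),
      ρ.IsIrreducible ∧ Function.Injective ρ ∧
      IsFrattiniExtension ρ S ∧ S.inl.range = frattini R ∧
      Nonempty (R ⧸ frattini R ≃* alternatingGroup (Fin 5)) ∧
      HasSchmidtSubgroup 3 5 R ∧
      ¬ HasSchmidtSubgroup 3 5 (alternatingGroup (Fin 5)) ∧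
      schmidtGraph (R ⧸ frattini R) ≠ schmidtGraph R := by
  refine ⟨⟨schmidtGraph_isArithmetic, schmidtGraph_sClosed, schmidtGraph_qClosed,
    schmidtGraph_d0Closed, schmidtGraph_r0Closed⟩, schmidtGraph_not_ePhiClosed,
    SumZero, inferInstance, inferInstance, sumZeroRep, frattiniCover, inferInstance, inferInstance,
    frattiniCoverExtension, sumZeroRep_isIrreducible, sumZeroRep_injective,
    ⟨frattiniCover_conj_inl, range_inl_le_frattini⟩, range_inl_eq_frattini,
    ⟨frattiniCoverQuotientEquiv⟩, hasSchmidtSubgroup_frattiniCover,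
    not_hasSchmidtSubgroup_alternatingGroup, fun h => ?_⟩
  have h3 : ((3, 5) : ℕ × ℕ) ∈ (schmidtGraph frattiniCover).edges :=
    hasSchmidtSubgroup_frattiniCover
  rw [← h, schmidtGraph_eq_of_mulEquiv frattiniCoverQuotientEquiv] at h3
  exact not_hasSchmidtSubgroup_alternatingGroup h3
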